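/- Let $G$ be a totally disconnected, locally compact topological group, and let $\alpha : G \to G$ be an endomorphism, that is, a continuous homomorphism. For every compact open subgroup $U \le G$ and every $n \ge 0$ the index $[\alpha^n(U) : U \cap \alpha^n(U)]$ is finite, where $\alpha^n$ denotes the $n$-fold composition of $\alpha$ with itself. The scale of $\alpha$ is the positive integer $$s(\alpha) := \min\{[\alpha(U) : U \cap \alpha(U)] \mid U \le G \text{ is a compact open subgroup}\}.$$ Then, for every endomorphism $\alpha$ of $G$ and every compact open subgroup $V$ of $G$, $$s(\alpha) = \lim_{n\to\infty} [\alpha^n(V) : V \cap \alpha^n(V)]^{1/n}.$$ -/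

import Mathlib

open Filter Topology

/-- The displacement index `[α(U) : U ∩ α(U)]` of a subgroup `U` under an endomorphism `α`.
`Subgroup.relIndex` is `0` when the index is infinite; for `α` continuous and `U` compact and open
the index is finite, see `displacementIndex_ne_zero`. -/
noncomputable def displacementIndex {G : Type*} [Group G] (α : Monoid.End G) (U : Subgroup G) : ℕ :=
  (U ⊓ Subgroup.map α U).relIndex (Subgroup.map α U)

/-- The set of displacement indices of the compact open subgroups of `G` under `α`. -/
def displacementIndices {G : Type*} [Group G] [TopologicalSpace G] (α : Monoid.End G) : Set ℕ :=
  {m | ∃ U : Subgroup G,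
    IsCompact (U : Set G) ∧ IsOpen (U : Set G) ∧ displacementIndex α U = m}

/-- The scale of `α`: the minimum of the displacement indices of the compact open subgroups.
For continuous `α` on a totally disconnected locally compact group this is a minimum that is
attained and positive, see `scale_isLeast` and `scale_pos`. -/
noncomputable def scale {G : Type*} [Group G] [TopologicalSpace G] (α : Monoid.End G) : ℕ :=
  sInf (displacementIndices α)

theorem displacementIndex_ne_zero {G : Type*} [Group G] [TopologicalSpace G]
    [IsTopologicalGroup G] (α : Monoid.End G) (hα : Continuous α) (U : Subgroup G)
    (hc : IsCompact (U : Set G)) (ho : IsOpen (U : Set G)) : displacementIndex α U ≠ 0 := by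
  have hK : IsCompact ((Subgroup.map α U : Subgroup G) : Set G) := hc.image hα
  have : CompactSpace (Subgroup.map α U) := isCompact_iff_compactSpace.mp hK
  rw [displacementIndex, Subgroup.inf_relIndex_right, Subgroup.relIndex]
  have hopen : IsOpen ((U.subgroupOf (Subgroup.map α U) : Subgroup (Subgroup.map α U)) :
      Set (Subgroup.map α U)) := ho.preimage continuous_subtype_val
  have := Subgroup.quotient_finite_of_isOpen _ hopen
  exact Subgroup.index_ne_zero_of_finite (H := U.subgroupOf (Subgroup.map α U))

theorem exists_compact_open_subgroup (G : Type*) [Group G] [TopologicalSpace G]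
    [IsTopologicalGroup G] [LocallyCompactSpace G] [TotallyDisconnectedSpace G] :
    ∃ U : Subgroup G, IsCompact (U : Set G) ∧ IsOpen (U : Set G) := by
  obtain ⟨K, hK, h1⟩ := exists_compact_mem_nhds (1 : G)
  obtain ⟨W, hW, h1W, hWK⟩ :=
    (loc_compact_Haus_tot_disc_of_zero_dim (H := G)).mem_nhds_iff.mp h1
  have hWc : IsCompact W := hK.of_isClosed_subset hW.isClosed hWK
  have key : ∀ᶠ g in 𝓝 (1 : G), ∀ w ∈ W, g * w ∈ W := by
    refine hWc.eventually_forall_of_forall_eventually fun w hw => ?_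
    have hcont : ContinuousAt (fun p : G × G => p.1 * p.2) (1, w) := continuous_mul.continuousAt
    exact hcont.eventually (hW.isOpen.mem_nhds (by simpa using hw))
  have key' : ∀ᶠ g in 𝓝 (1 : G), ∀ w ∈ W, g⁻¹ * w ∈ W := by
    have hinv : Tendsto (fun g : G => g⁻¹) (𝓝 1) (𝓝 1) := by
      simpa using (continuous_inv.tendsto (1 : G))
    exact hinv.eventually key
  let H : Subgroup G :=
    { carrier := {g | (∀ w ∈ W, g * w ∈ W) ∧ ∀ w ∈ W, g⁻¹ * w ∈ W}
      one_mem' := by simp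
      mul_mem' := by
        rintro a b ⟨ha, ha'⟩ ⟨hb, hb'⟩
        refine ⟨fun w hw => ?_, fun w hw => ?_⟩
        · rw [mul_assoc]; exact ha _ (hb _ hw)
        · rw [mul_inv_rev, mul_assoc]; exact hb' _ (ha' _ hw)
      inv_mem' := by
        rintro a ⟨ha, ha'⟩
        exact ⟨ha', by simpa using ha⟩ }
  have hH : IsOpen (H : Set G) := H.isOpen_of_mem_nhds (g := 1) (key.and key')
  refine ⟨H, hWc.of_isClosed_subset (H.isClosed_of_isOpen hH) fun g hg => ?_, hH⟩
  simpa using hg.1 1 h1W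

/-- The scale is attained: it is the least displacement index. -/
theorem scale_isLeast {G : Type*} [Group G] [TopologicalSpace G] [IsTopologicalGroup G]
    [LocallyCompactSpace G] [TotallyDisconnectedSpace G] (α : Monoid.End G) :
    IsLeast (displacementIndices α) (scale α) := by
  obtain ⟨U, hc, ho⟩ := exists_compact_open_subgroup G
  exact ⟨Nat.sInf_mem ⟨_, U, hc, ho, rfl⟩, fun m hm => Nat.sInf_le hm⟩

theorem scale_pos {G : Type*} [Group G] [TopologicalSpace G] [IsTopologicalGroup G]
    [LocallyCompactSpace G] [TotallyDisconnectedSpace G] (α : Monoid.End G)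
    (hα : Continuous α) : 0 < scale α := by
  obtain ⟨U, hc, ho, h⟩ := (scale_isLeast α).1
  exact h ▸ Nat.pos_of_ne_zero (displacementIndex_ne_zero α hα U hc ho)

open scoped Pointwise

/-! ### Iterates of an endomorphism acting on subgroups. -/

section Iterates

variable {G : Type*} [Group G] (α : Monoid.End G)

/-! Write d_n(V) for the displacement index of V under α^n. For any two compact open subgroups the
d_n agree up to constant factors (`exists_displacementIndex_pow_le_mul`), which disappear under n-th
roots, so V may be replaced by a convenient subgroup. A minimizing U gives the upper bound, as
d_n(U) ≤ d_1(U)^n (`displacementIndex_pow_le_pow`). The lower bound needs a W with d_1(W)^n ≤ d_n(W)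
(`exists_displacementIndex_pow_le`), since d_1(W) is at least the scale.

Such a W factors as T Q with T ≤ α(T), α(Q) ≤ Q and α^n(T) ∩ W ≤ T. Then d_1(W) = [α(T) : T], and
[α^n(T) : T] is its n-th power once kernels are controlled. Compactness gives a Y that is the
product of its backward and forward cores (`exists_finiteForwardCore_eq_mul`), but forward images of
the backward core may re-enter Y. The re-entering elements are caught by the homoclinic subgroup of
U, whose closure L is compact with α(L) = L. Taking Y ≤ U normalized by L, W = Y L and T = (backward
core of Y) L removes this obstruction and the kernel problem together. -/

theorem Monoid.End.pow_add_apply (m n : ℕ) (x : G) : (α ^ (m + n)) x = (α ^ m) ((α ^ n) x) := by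
  rw [pow_add]; rfl

theorem Monoid.End.pow_succ_apply (n : ℕ) (x : G) : (α ^ (n + 1)) x = (α ^ n) (α x) := by
  rw [pow_succ]; rfl

theorem Monoid.End.pow_succ_apply' (n : ℕ) (x : G) : (α ^ (n + 1)) x = α ((α ^ n) x) := by
  rw [pow_succ']; rfl

theorem Monoid.End.continuous_pow [TopologicalSpace G] (hα : Continuous α) (n : ℕ) :
    Continuous (α ^ n) := by
  rw [Monoid.End.coe_pow]; exact hα.iterate n

theorem Subgroup.pow_mem_of_map_le {H : Subgroup G} (h : H.map α ≤ H) (n : ℕ) {x : G}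
    (hx : x ∈ H) : (α ^ n) x ∈ H := by
  induction n with
  | zero => exact hx
  | succ n ih =>
    rw [Monoid.End.pow_succ_apply']
    exact h (Subgroup.mem_map_of_mem α ih)

theorem Subgroup.map_pow_succ (H : Subgroup G) (n : ℕ) :
    H.map (α ^ (n + 1)) = (H.map α).map (α ^ n) := by
  rw [pow_succ]; exact (Subgroup.map_map H (α ^ n) α).symm

theorem Subgroup.map_pow_one (H : Subgroup G) : H.map (α ^ 1) = H.map α :=
  congrArg (fun β : Monoid.End G => H.map β) (pow_one α)

theorem Subgroup.map_pow_mono {H : Subgroup G} (h : H ≤ H.map α) :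
    Monotone fun n : ℕ => H.map (α ^ n) := by
  refine monotone_nat_of_le_succ fun n => ?_
  rw [Subgroup.map_pow_succ]
  exact Subgroup.map_mono h

theorem Subgroup.map_pow_eq_self {H : Subgroup G} (h : H.map α = H) (n : ℕ) :
    H.map (α ^ n) = H := by
  induction n with
  | zero => exact Subgroup.map_id H
  | succ n ih => rw [Subgroup.map_pow_succ, h, ih]

end Iterates

/-! ### Forward and backward cores. -/

section Cores

variable {G : Type*} [Group G] (α : Monoid.End G) (U : Subgroup G)

/-- The elements whose first `n` images under `α` stay in `U`. -/
def finiteForwardCore (n : ℕ) : Subgroup G := ⨅ k : Fin (n + 1), U.comap (α ^ (k : ℕ))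

/-- The elements whose forward `α`-orbit stays in `U`. -/
def forwardCore : Subgroup G := ⨅ n : ℕ, finiteForwardCore α U n

/-- The elements with arbitrarily long backward `α`-trajectories in `U`. -/
def backwardCore : Subgroup G := ⨅ n : ℕ, (finiteForwardCore α U n).map (α ^ n)

variable {α U}

theorem mem_finiteForwardCore {n : ℕ} {x : G} :
    x ∈ finiteForwardCore α U n ↔ ∀ k ≤ n, (α ^ k) x ∈ U := by
  simp only [finiteForwardCore, Subgroup.mem_iInf, Fin.forall_iff,
    Nat.lt_succ_iff]
  rfl

theorem mem_forwardCore {x : G} : x ∈ forwardCore α U ↔ ∀ k, (α ^ k) x ∈ U := by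
  simp only [forwardCore, Subgroup.mem_iInf, mem_finiteForwardCore]
  exact ⟨fun h k => h k k le_rfl, fun h n k _ => h k⟩

theorem mem_backwardCore {x : G} :
    x ∈ backwardCore α U ↔ ∀ n, ∃ y ∈ finiteForwardCore α U n, (α ^ n) y = x := by
  simp only [backwardCore, Subgroup.mem_iInf]
  rfl

theorem finiteForwardCore_antitone : Antitone (finiteForwardCore α U) := fun _ _ h _ hx =>
  mem_finiteForwardCore.mpr fun k hk => mem_finiteForwardCore.mp hx k (hk.trans h)

theorem finiteForwardCore_le (n : ℕ) : finiteForwardCore α U n ≤ U := fun _ hx =>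
  mem_finiteForwardCore.mp hx 0 n.zero_le

theorem forwardCore_le : forwardCore α U ≤ U := fun _ hx => mem_forwardCore.mp hx 0

theorem backwardCore_le : backwardCore α U ≤ U := fun x hx => by
  obtain ⟨y, hy, rfl⟩ := mem_backwardCore.mp hx 0
  exact mem_finiteForwardCore.mp hy 0 le_rfl

theorem forwardCore_mono {V : Subgroup G} (h : U ≤ V) : forwardCore α U ≤ forwardCore α V :=
  fun _ hx => mem_forwardCore.mpr fun k => h (mem_forwardCore.mp hx k)

theorem backwardCore_mono {V : Subgroup G} (h : U ≤ V) : backwardCore α U ≤ backwardCore α V :=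
  fun _ hx => mem_backwardCore.mpr fun n =>
    let ⟨y, hy, hyx⟩ := mem_backwardCore.mp hx n
    ⟨y, mem_finiteForwardCore.mpr fun k hk => h (mem_finiteForwardCore.mp hy k hk), hyx⟩

theorem map_forwardCore_le : (forwardCore α U).map α ≤ forwardCore α U := by
  rintro _ ⟨x, hx, rfl⟩
  refine mem_forwardCore.mpr fun k => ?_
  have := mem_forwardCore.mp hx (k + 1)
  rwa [Monoid.End.pow_succ_apply] at this

theorem exists_pow_eq_of_le_map {H : Subgroup G} (h : H ≤ H.map α) (n : ℕ) {x : G} (hx : x ∈ H) :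
    ∃ y ∈ finiteForwardCore α H n, (α ^ n) y = x := by
  induction n generalizing x with
  | zero => exact ⟨x, mem_finiteForwardCore.mpr fun k hk => by rwa [Nat.le_zero.mp hk], rfl⟩
  | succ n ih =>
    obtain ⟨y, hy, rfl⟩ := ih hx
    obtain ⟨z, hz, hzy⟩ := h (finiteForwardCore_le n hy)
    have hzy : α z = y := hzy
    refine ⟨z, mem_finiteForwardCore.mpr fun k hk => ?_, by rw [Monoid.End.pow_succ_apply, hzy]⟩
    cases k with
    | zero => exact hz
    | succ k =>
      rw [Monoid.End.pow_succ_apply, hzy]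
      exact mem_finiteForwardCore.mp hy k (by omega)

/-- `backwardCore α U` contains every subgroup of `U` that is contained in its image. -/
theorem le_backwardCore {H : Subgroup G} (hU : H ≤ U) (h : H ≤ H.map α) :
    H ≤ backwardCore α U := fun _ hx => mem_backwardCore.mpr fun n =>
  let ⟨y, hy, hyx⟩ := exists_pow_eq_of_le_map h n hx
  ⟨y, mem_finiteForwardCore.mpr fun k hk => hU (mem_finiteForwardCore.mp hy k hk), hyx⟩

theorem map_finiteForwardCore_antitone :
    Antitone fun n : ℕ => (finiteForwardCore α U n).map (α ^ n) := by
  refine antitone_nat_of_succ_le fun n => ?_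
  rintro _ ⟨x, hx, rfl⟩
  refine ⟨α x, mem_finiteForwardCore.mpr fun k hk => ?_, (Monoid.End.pow_succ_apply α n x).symm⟩
  rw [← Monoid.End.pow_succ_apply]
  exact mem_finiteForwardCore.mp hx (k + 1) (by omega)

theorem conj_mem_finiteForwardCore {n : ℕ} {l x : G}
    (hl : ∀ k, ∀ y ∈ U, (α ^ k) l * y * ((α ^ k) l)⁻¹ ∈ U) (hx : x ∈ finiteForwardCore α U n) :
    l * x * l⁻¹ ∈ finiteForwardCore α U n := by
  refine mem_finiteForwardCore.mpr fun k hk => ?_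
  rw [map_mul, map_mul, map_inv]
  exact hl k _ (mem_finiteForwardCore.mp hx k hk)

theorem conj_mem_forwardCore {l x : G}
    (hl : ∀ k, ∀ y ∈ U, (α ^ k) l * y * ((α ^ k) l)⁻¹ ∈ U) (hx : x ∈ forwardCore α U) :
    l * x * l⁻¹ ∈ forwardCore α U := by
  refine mem_forwardCore.mpr fun k => ?_
  rw [map_mul, map_mul, map_inv]
  exact hl k _ (mem_forwardCore.mp hx k)

/-- As α(L) = L, the conjugator is α^n(m) for some m in L, and conjugating by m carries a whole
trajectory of length n inside U to another one. -/
theorem conj_mem_backwardCore {L : Subgroup G} (hLα : L.map α = L)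
    (hLU : ∀ l ∈ L, ∀ y ∈ U, l * y * l⁻¹ ∈ U) {l x : G} (hl : l ∈ L)
    (hx : x ∈ backwardCore α U) : l * x * l⁻¹ ∈ backwardCore α U := by
  refine mem_backwardCore.mpr fun n => ?_
  obtain ⟨y, hy, rfl⟩ := mem_backwardCore.mp hx n
  rw [← Subgroup.map_pow_eq_self α hLα n] at hl
  obtain ⟨m, hm, rfl⟩ := hl
  refine ⟨m * y * m⁻¹, conj_mem_finiteForwardCore (fun k => hLU _ ?_) hy, ?_⟩
  · exact Subgroup.pow_mem_of_map_le α hLα.le k hm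
  · rw [map_mul, map_mul, map_inv]; rfl

end Cores

/-! ### Compactness of the cores and tidying above. -/

section TopologicalCores

variable {G : Type*} [Group G] [TopologicalSpace G] {α : Monoid.End G} {U : Subgroup G}

theorem isClosed_finiteForwardCore (hα : Continuous α) (hU : IsClosed (U : Set G)) (n : ℕ) :
    IsClosed (finiteForwardCore α U n : Set G) := by
  simp only [finiteForwardCore, Subgroup.coe_iInf]
  exact isClosed_iInter fun k => hU.preimage (Monoid.End.continuous_pow α hα k)

theorem isOpen_finiteForwardCore (hα : Continuous α) (hU : IsOpen (U : Set G)) (n : ℕ) :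
    IsOpen (finiteForwardCore α U n : Set G) := by
  simp only [finiteForwardCore, Subgroup.coe_iInf]
  exact isOpen_iInter_of_finite fun k => hU.preimage (Monoid.End.continuous_pow α hα k)

theorem isClosed_forwardCore (hα : Continuous α) (hU : IsClosed (U : Set G)) :
    IsClosed (forwardCore α U : Set G) := by
  simp only [forwardCore, Subgroup.coe_iInf]
  exact isClosed_iInter fun n => isClosed_finiteForwardCore hα hU n

variable [IsTopologicalGroup G]

theorem isCompact_finiteForwardCore (hα : Continuous α) (hUo : IsOpen (U : Set G))
    (hUc : IsCompact (U : Set G)) (n : ℕ) : IsCompact (finiteForwardCore α U n : Set G) :=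
  hUc.of_isClosed_subset (isClosed_finiteForwardCore hα (U.isClosed_of_isOpen hUo) n)
    (finiteForwardCore_le n)

theorem isCompact_map_finiteForwardCore (hα : Continuous α) (hUo : IsOpen (U : Set G))
    (hUc : IsCompact (U : Set G)) (n : ℕ) :
    IsCompact ((finiteForwardCore α U n).map (α ^ n) : Set G) :=
  (isCompact_finiteForwardCore hα hUo hUc n).image (Monoid.End.continuous_pow α hα n)

variable [T2Space G]

theorem isCompact_backwardCore (hα : Continuous α) (hUo : IsOpen (U : Set G))
    (hUc : IsCompact (U : Set G)) : IsCompact (backwardCore α U : Set G) := by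
  refine hUc.of_isClosed_subset ?_ backwardCore_le
  simp only [backwardCore, Subgroup.coe_iInf]
  exact isClosed_iInter fun n => (isCompact_map_finiteForwardCore hα hUo hUc n).isClosed

/-- The fibre of α over x meets each of the nested compact sets α^n(U_n), U_n being the n-th finite
forward core, and hence meets their intersection. -/
theorem backwardCore_le_map (hα : Continuous α) (hUo : IsOpen (U : Set G))
    (hUc : IsCompact (U : Set G)) : backwardCore α U ≤ (backwardCore α U).map α := by
  intro x hx
  have hne := IsCompact.nonempty_iInter_of_sequence_nonempty_isCompact_isClosed
    (fun n => ((finiteForwardCore α U n).map (α ^ n) : Set G) ∩ α ⁻¹' {x})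
    (fun n => Set.inter_subset_inter_left _ (map_finiteForwardCore_antitone n.le_succ))
    (fun n => ?_)
    ((isCompact_map_finiteForwardCore hα hUo hUc 0).inter_right
      (isClosed_singleton.preimage hα))
    (fun n => (isCompact_map_finiteForwardCore hα hUo hUc n).isClosed.inter
      (isClosed_singleton.preimage hα))
  · obtain ⟨y, hy⟩ := hne
    rw [Set.mem_iInter] at hy
    exact ⟨y, Subgroup.mem_iInf.mpr fun n => (hy n).1, (hy 0).2⟩
  · obtain ⟨y, hy, hyx⟩ := mem_backwardCore.mp hx (n + 1)
    refine ⟨(α ^ n) y, ⟨y, finiteForwardCore_antitone n.le_succ hy, rfl⟩, ?_⟩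
    rw [Set.mem_preimage, ← Monoid.End.pow_succ_apply', hyx]
    rfl

theorem map_backwardCore_inf_le (hα : Continuous α) (hUo : IsOpen (U : Set G))
    (hUc : IsCompact (U : Set G)) : (backwardCore α U).map α ⊓ U ≤ backwardCore α U := by
  refine le_backwardCore inf_le_right ?_
  rintro _ ⟨⟨z, hz, rfl⟩, -⟩
  exact ⟨z, ⟨backwardCore_le_map hα hUo hUc hz, backwardCore_le hz⟩, rfl⟩

/-- Tidying above: for large `n`, the subgroup `finiteForwardCore α U n` is the product of its
backward and forward cores. -/
theorem exists_finiteForwardCore_eq_mul (hα : Continuous α) (hUo : IsOpen (U : Set G))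
    (hUc : IsCompact (U : Set G)) :
    ∃ N, ∀ y ∈ finiteForwardCore α U N, ∃ p ∈ backwardCore α (finiteForwardCore α U N),
      ∃ q ∈ forwardCore α (finiteForwardCore α U N), y = p * q := by
  have hmap := backwardCore_le_map hα hUo hUc
  -- The right side is an open neighbourhood of the intersection of the decreasing compact sets on
  -- the left.
  obtain ⟨N, hN⟩ : ∃ N, ((finiteForwardCore α U N).map (α ^ N) : Set G) ⊆
      (backwardCore α U : Set G) * α ⁻¹' (U : Set G) := by
    refine exists_subset_nhds_of_isCompact' map_finiteForwardCore_antitone.directed_ge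
      (fun n => isCompact_map_finiteForwardCore hα hUo hUc n)
      (fun n => (isCompact_map_finiteForwardCore hα hUo hUc n).isClosed) fun x hx => ?_
    refine ((hUo.preimage hα).mul_left).mem_nhds ⟨x, ?_, 1, by simp [U.one_mem], mul_one x⟩
    exact Subgroup.mem_iInf.mpr (Set.mem_iInter.mp hx)
  set Y := finiteForwardCore α U N
  have hS : finiteForwardCore α (backwardCore α U) N ≤ backwardCore α Y := by
    refine le_backwardCore (fun x hx => mem_finiteForwardCore.mpr fun k hk =>
      backwardCore_le (mem_finiteForwardCore.mp hx k hk)) fun x hx => ?_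
    obtain ⟨z, hz, rfl⟩ := hmap (finiteForwardCore_le N hx)
    refine ⟨z, mem_finiteForwardCore.mpr fun k hk => ?_, rfl⟩
    cases k with
    | zero => exact hz
    | succ k =>
      rw [Monoid.End.pow_succ_apply]
      exact mem_finiteForwardCore.mp hx k (by omega)
  -- If α^m(y) = α^m(r) q with α(q) in U, then dividing y by r buys one more step in U, since
  -- α^(m+1)(r⁻¹ y) = α(q).
  have hstep : ∀ m ≥ N, ∀ y ∈ finiteForwardCore α U m, ∃ p ∈ backwardCore α Y,
      p⁻¹ * y ∈ finiteForwardCore α U (m + 1) := by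
    intro m hm y hy
    obtain ⟨p, hp, q, hq, hpq⟩ := hN (map_finiteForwardCore_antitone hm ⟨y, hy, rfl⟩)
    obtain ⟨r, hr, rfl⟩ := exists_pow_eq_of_le_map hmap m hp
    have hpq : (α ^ m) r * q = (α ^ m) y := hpq
    refine ⟨r, hS (finiteForwardCore_antitone hm hr), mem_finiteForwardCore.mpr fun k hk => ?_⟩
    rcases Nat.lt_or_ge m k with h | h
    · obtain rfl : k = m + 1 := by omega
      rw [Monoid.End.pow_succ_apply', map_mul, map_inv, ← hpq, inv_mul_cancel_left]
      exact hq
    · rw [map_mul, map_inv]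
      exact U.mul_mem (U.inv_mem (backwardCore_le (mem_finiteForwardCore.mp hr k h)))
        (mem_finiteForwardCore.mp hy k h)
  have hstep' : ∀ m, ∀ y ∈ Y, ∃ p ∈ backwardCore α Y,
      p⁻¹ * y ∈ finiteForwardCore α U (N + m) := by
    intro m y hy
    induction m with
    | zero => exact ⟨1, one_mem _, by simpa using hy⟩
    | succ m ih =>
      obtain ⟨p, hp, hpy⟩ := ih
      obtain ⟨r, hr, hry⟩ := hstep _ (Nat.le_add_right N m) _ hpy
      exact ⟨p * r, mul_mem hp hr, by rwa [mul_inv_rev, mul_assoc]⟩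
  have hYo : IsOpen (Y : Set G) := isOpen_finiteForwardCore hα hUo N
  have hYc : IsCompact (Y : Set G) := isCompact_finiteForwardCore hα hUo hUc N
  have hcore : IsCompact (backwardCore α Y : Set G) := isCompact_backwardCore hα hYo hYc
  refine ⟨N, fun y hy => ?_⟩
  have hcl : ∀ m, IsClosed {p : G | p⁻¹ * y ∈ finiteForwardCore α U (N + m)} := fun m =>
    (isClosed_finiteForwardCore hα (U.isClosed_of_isOpen hUo) (N + m)).preimage
      (continuous_inv.mul continuous_const)
  -- Compactness yields one p that works for all m at once.
  obtain ⟨p, hp⟩ := IsCompact.nonempty_iInter_of_sequence_nonempty_isCompact_isClosed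
    (fun m => (backwardCore α Y : Set G) ∩ {p | p⁻¹ * y ∈ finiteForwardCore α U (N + m)})
    (fun m => Set.inter_subset_inter_right _ fun p hp =>
      finiteForwardCore_antitone (by omega) hp)
    (fun m => hstep' m y hy) (hcore.inter_right (hcl 0)) (fun m => hcore.isClosed.inter (hcl m))
  rw [Set.mem_iInter] at hp
  refine ⟨p, (hp 0).1, p⁻¹ * y, mem_forwardCore.mpr fun k => mem_finiteForwardCore.mpr fun j _ => ?_,
    (mul_inv_cancel_left p y).symm⟩
  rw [← Monoid.End.pow_add_apply]
  exact mem_finiteForwardCore.mp (hp (j + k)).2 (j + k) (by omega)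

end TopologicalCores

/-! ### The homoclinic subgroup and its invariance. -/

section Homoclinic

variable {G : Type*} [Group G] (α : Monoid.End G) (U : Subgroup G)

/-- The elements whose forward orbit under `α` ends in `forwardCore α U` and that have a backward
trajectory ending in `backwardCore α U`. -/
def homoclinicSubgroup : Subgroup G :=
  (⨆ m : ℕ, (backwardCore α U).map (α ^ m)) ⊓ ⨆ n : ℕ, (forwardCore α U).comap (α ^ n)

variable {α U}

theorem comap_pow_forwardCore_mono :
    Monotone fun n : ℕ => (forwardCore α U).comap (α ^ n) := by
  refine monotone_nat_of_le_succ fun n x hx => ?_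
  change (α ^ (n + 1)) x ∈ forwardCore α U
  rw [Monoid.End.pow_succ_apply']
  exact map_forwardCore_le (Subgroup.mem_map_of_mem α hx)

theorem mem_homoclinicSubgroup (h : backwardCore α U ≤ (backwardCore α U).map α) {x : G} :
    x ∈ homoclinicSubgroup α U ↔
      (∃ m, x ∈ (backwardCore α U).map (α ^ m)) ∧ ∃ n, (α ^ n) x ∈ forwardCore α U := by
  rw [homoclinicSubgroup, Subgroup.mem_inf,
    Subgroup.mem_iSup_of_directed (Subgroup.map_pow_mono α h).directed_le,
    Subgroup.mem_iSup_of_directed comap_pow_forwardCore_mono.directed_le]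
  rfl

theorem map_homoclinicSubgroup (h : backwardCore α U ≤ (backwardCore α U).map α) :
    (homoclinicSubgroup α U).map α = homoclinicSubgroup α U := by
  refine le_antisymm ?_ fun x hx => ?_
  · rintro _ ⟨x, hx, rfl⟩
    obtain ⟨⟨m, y, hy, rfl⟩, n, hn⟩ := (mem_homoclinicSubgroup h).mp hx
    refine (mem_homoclinicSubgroup h).mpr ⟨⟨m + 1, y, hy, ?_⟩, n, ?_⟩
    · exact Monoid.End.pow_succ_apply' α m y
    · have := map_forwardCore_le (Subgroup.mem_map_of_mem α hn)
      change α ((α ^ n) _) ∈ _ at this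
      rwa [← Monoid.End.pow_succ_apply', Monoid.End.pow_succ_apply] at this
  · obtain ⟨⟨m, hm⟩, n, hn⟩ := (mem_homoclinicSubgroup h).mp hx
    -- Raising m to m + 1 exposes a preimage α^m(y) of x, which enters the forward core one step
    -- later than x.
    obtain ⟨y, hy, rfl⟩ := Subgroup.map_pow_mono α h m.le_succ hm
    change (α ^ n) ((α ^ (m + 1)) y) ∈ _ at hn
    rw [Monoid.End.pow_succ_apply', ← Monoid.End.pow_succ_apply] at hn
    refine ⟨(α ^ m) y, (mem_homoclinicSubgroup h).mpr ⟨⟨m, y, hy, rfl⟩, n + 1, hn⟩, ?_⟩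
    exact (Monoid.End.pow_succ_apply' α m y).symm

end Homoclinic

/-! ### Compactness of the closure of the homoclinic subgroup. -/

section HomoclinicCompact

variable {G : Type*} [Group G] [TopologicalSpace G] [IsTopologicalGroup G] [T2Space G]
  {α : Monoid.End G} {U : Subgroup G}

theorem Subgroup.relIndex_ne_zero_of_isOpen_of_isCompact {G : Type*} [Group G]
    [TopologicalSpace G] [IsTopologicalGroup G] {U K : Subgroup G} (hU : IsOpen (U : Set G))
    (hK : IsCompact (K : Set G)) : U.relIndex K ≠ 0 := by
  have : CompactSpace K := isCompact_iff_compactSpace.mp hK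
  have hopen : IsOpen ((U.subgroupOf K : Subgroup K) : Set K) :=
    hU.preimage continuous_subtype_val
  have := Subgroup.quotient_finite_of_isOpen _ hopen
  exact Subgroup.index_ne_zero_of_finite (H := U.subgroupOf K)

/-- Finitely many cosets of U cover M, so a single N bounds the time their representatives need to
reach the forward core. Splitting off such representatives lowers the exponent of α one step at a
time until N is reached. -/
theorem homoclinicSubgroup_subset_mul (hα : Continuous α) (hUo : IsOpen (U : Set G))
    (hUc : IsCompact (U : Set G)) : ∃ N, ∀ x ∈ homoclinicSubgroup α U,
      ∃ p ∈ (backwardCore α U).map (α ^ N), ∃ u ∈ forwardCore α U ⊓ homoclinicSubgroup α U,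
        p * u = x := by
  have hB := backwardCore_le_map hα hUo hUc
  set M := (backwardCore α U).map α ⊓ homoclinicSubgroup α U
  have hfin : Finite (M ⧸ U.subgroupOf M) := by
    refine Nat.finite_of_card_ne_zero fun h0 => ?_
    exact Subgroup.relIndex_ne_zero_of_isOpen_of_isCompact hUo
      ((isCompact_backwardCore hα hUo hUc).image hα)
      (Subgroup.relIndex_eq_zero_of_le_right (inf_le_left : M ≤ _) h0)
  have hout : ∀ q : M ⧸ U.subgroupOf M, ∃ n, ((q.out : M) : G) ∈ (forwardCore α U).comap (α ^ n) :=
    fun q => ((mem_homoclinicSubgroup hB).mp q.out.2.2).2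
  choose f hf using hout
  obtain ⟨N, hN⟩ := (Set.finite_range f).bddAbove
  have hrep : ∀ x ∈ M, ∃ a ∈ backwardCore α U, ∃ v ∈ M, (α ^ N) v ∈ forwardCore α U ∧ a * v = x := by
    intro x hx
    -- The class of x⁻¹ is used because cosets are left cosets: its representative times x on the
    -- left lies in U.
    set q : M ⧸ U.subgroupOf M := QuotientGroup.mk (⟨x, hx⟩⁻¹ : M)
    have hxv : x * (q.out : M) ∈ U := by
      have := QuotientGroup.eq.mp (q.out_eq'.symm)
      rw [Subgroup.mem_subgroupOf] at this
      simpa using this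
    refine ⟨x * (q.out : M), ?_, ((q.out : M) : G)⁻¹, M.inv_mem q.out.2, ?_, by group⟩
    · exact map_backwardCore_inf_le hα hUo hUc ⟨mul_mem hx.1 q.out.2.1, hxv⟩
    · rw [map_inv]
      exact inv_mem (comap_pow_forwardCore_mono (hN ⟨q, rfl⟩) (hf q))
  have key : ∀ m, ∀ x ∈ homoclinicSubgroup α U, x ∈ (backwardCore α U).map (α ^ (N + m)) →
      ∃ p ∈ (backwardCore α U).map (α ^ N), ∃ u ∈ forwardCore α U ⊓ homoclinicSubgroup α U,
        p * u = x := by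
    intro m
    induction m with
    | zero => exact fun x _ hx => ⟨x, hx, 1, one_mem _, mul_one x⟩
    | succ m ih =>
      rintro x hx ⟨y, hy, rfl⟩
      have hL := map_homoclinicSubgroup hB
      have hyM : α y ∈ M := by
        refine ⟨⟨y, hy, rfl⟩, (mem_homoclinicSubgroup hB).mpr ⟨⟨1, y, hy, ?_⟩, ?_⟩⟩
        · exact Monoid.End.pow_succ_apply α 0 y
        · obtain ⟨n, hn⟩ := ((mem_homoclinicSubgroup hB).mp hx).2
          change (α ^ n) ((α ^ (N + m + 1)) y) ∈ _ at hn
          rw [Monoid.End.pow_succ_apply, ← Monoid.End.pow_add_apply] at hn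
          exact ⟨_, hn⟩
      obtain ⟨a, ha, v, hv, hvN, hav⟩ := hrep _ hyM
      have hvm : (α ^ (N + m)) v ∈ forwardCore α U ⊓ homoclinicSubgroup α U := by
        refine ⟨?_, Subgroup.pow_mem_of_map_le α hL.le _ hv.2⟩
        rw [add_comm, Monoid.End.pow_add_apply]
        exact Subgroup.pow_mem_of_map_le α map_forwardCore_le _ hvN
      have haL : a ∈ homoclinicSubgroup α U := by
        rw [eq_mul_inv_of_mul_eq hav]
        exact mul_mem hyM.2 (inv_mem hv.2)
      obtain ⟨p, hp, u, hu, hpu⟩ := ih ((α ^ (N + m)) a)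
        (Subgroup.pow_mem_of_map_le α hL.le _ haL) ⟨a, ha, rfl⟩
      refine ⟨p, hp, u * (α ^ (N + m)) v, mul_mem hu hvm, ?_⟩
      rw [← mul_assoc, hpu, ← map_mul, hav]
      exact (Monoid.End.pow_succ_apply α (N + m) y).symm
  refine ⟨N, fun x hx => ?_⟩
  obtain ⟨m, hm⟩ := ((mem_homoclinicSubgroup hB).mp hx).1
  exact key m x hx (Subgroup.map_pow_mono α hB (Nat.le_add_left m N) hm)

/-- A product of two compact sets is closed, so the factorization passes to the closure. -/
theorem closure_homoclinicSubgroup (hα : Continuous α) (hUo : IsOpen (U : Set G))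
    (hUc : IsCompact (U : Set G)) :
    IsCompact ((homoclinicSubgroup α U).topologicalClosure : Set G) ∧
      ∃ N, ∀ x ∈ (homoclinicSubgroup α U).topologicalClosure,
        ∃ p ∈ (backwardCore α U).map (α ^ N),
          ∃ u ∈ forwardCore α U ⊓ (homoclinicSubgroup α U).topologicalClosure, p * u = x := by
  obtain ⟨N, hN⟩ := homoclinicSubgroup_subset_mul hα hUo hUc
  have hP : IsCompact ((backwardCore α U).map (α ^ N) : Set G) :=
    (isCompact_backwardCore hα hUo hUc).image (Monoid.End.continuous_pow α hα N)
  have hQ : IsCompact ((forwardCore α U ⊓ (homoclinicSubgroup α U).topologicalClosure :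
      Subgroup G) : Set G) :=
    hUc.of_isClosed_subset ((isClosed_forwardCore hα (U.isClosed_of_isOpen hUo)).inter
      (Subgroup.isClosed_topologicalClosure _)) fun x hx => forwardCore_le hx.1
  have hsub : ((homoclinicSubgroup α U).topologicalClosure : Set G) ⊆
      ((backwardCore α U).map (α ^ N) : Set G) *
        ((forwardCore α U ⊓ (homoclinicSubgroup α U).topologicalClosure : Subgroup G) : Set G) := by
    refine closure_minimal (fun x hx => ?_) (hP.mul hQ).isClosed
    obtain ⟨p, hp, u, hu, rfl⟩ := hN x hx
    exact ⟨p, hp, u, ⟨hu.1, Subgroup.le_topologicalClosure _ hu.2⟩, rfl⟩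
  refine ⟨(hP.mul hQ).of_isClosed_subset (Subgroup.isClosed_topologicalClosure _) hsub,
    N, fun x hx => ?_⟩
  obtain ⟨p, hp, u, hu, rfl⟩ := hsub hx
  exact ⟨p, hp, u, hu, rfl⟩

theorem map_closure_homoclinicSubgroup (hα : Continuous α) (hUo : IsOpen (U : Set G))
    (hUc : IsCompact (U : Set G)) :
    (homoclinicSubgroup α U).topologicalClosure.map α =
      (homoclinicSubgroup α U).topologicalClosure := by
  have hL := map_homoclinicSubgroup (backwardCore_le_map hα hUo hUc)
  refine le_antisymm ?_ (Subgroup.topologicalClosure_minimal _ ?_ ?_)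
  · rintro _ ⟨x, hx, rfl⟩
    refine map_mem_closure hα hx fun y hy => ?_
    exact hL.le (Subgroup.mem_map_of_mem α hy)
  · exact hL.ge.trans (Subgroup.map_mono (Subgroup.le_topologicalClosure _))
  · exact ((closure_homoclinicSubgroup hα hUo hUc).1.image hα).isClosed

/-- An element of the forward images of `backwardCore α U` times the compact group
`(homoclinicSubgroup α U).topologicalClosure` that is eventually mapped into `forwardCore α U`
belongs to the compact group. -/
theorem mem_closure_homoclinicSubgroup (hα : Continuous α) (hUo : IsOpen (U : Set G))
    (hUc : IsCompact (U : Set G)) {m n : ℕ} {z l : G}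
    (hz : z ∈ (backwardCore α U).map (α ^ m))
    (hl : l ∈ (homoclinicSubgroup α U).topologicalClosure)
    (hzl : (α ^ n) (z * l) ∈ forwardCore α U) :
    z * l ∈ (homoclinicSubgroup α U).topologicalClosure := by
  have hB := backwardCore_le_map hα hUo hUc
  obtain ⟨N, hN⟩ := (closure_homoclinicSubgroup hα hUo hUc).2
  obtain ⟨p, hp, u, hu, rfl⟩ := hN l hl
  have hzp : z * p ∈ homoclinicSubgroup α U := by
    refine (mem_homoclinicSubgroup hB).mpr ⟨⟨m + N, mul_mem ?_ ?_⟩, n, ?_⟩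
    · exact Subgroup.map_pow_mono α hB (Nat.le_add_right m N) hz
    · exact Subgroup.map_pow_mono α hB (Nat.le_add_left N m) hp
    -- The factor u stays in the forward core under α, so removing it does not affect membership.
    · rw [show z * p = z * (p * u) * u⁻¹ by group, map_mul, map_inv]
      exact mul_mem hzl (inv_mem (Subgroup.pow_mem_of_map_le α map_forwardCore_le n hu.1))
  rw [← mul_assoc]
  exact mul_mem (Subgroup.le_topologicalClosure _ hzp) hu.2

end HomoclinicCompact

/-! ### Index computations for a factored subgroup. -/

section Index

variable {G : Type*} [Group G]

theorem Subgroup.relIndex_eq_of_forall_exists_inv_mul_mem {H K K' : Subgroup G} (hle : K' ≤ K)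
    (h : ∀ k ∈ K, ∃ k' ∈ K', k'⁻¹ * k ∈ H) : H.relIndex K = H.relIndex K' := by
  refine (Nat.card_congr (Equiv.ofBijective (Subgroup.quotientSubgroupOfEmbeddingOfLE H hle)
    ⟨(Subgroup.quotientSubgroupOfEmbeddingOfLE H hle).injective, fun q => ?_⟩)).symm
  induction q using QuotientGroup.induction_on with
  | H k =>
    obtain ⟨k', hk', hkk⟩ := h k k.2
    refine ⟨QuotientGroup.mk ⟨k', hk'⟩, ?_⟩
    exact QuotientGroup.eq.mpr (Subgroup.mem_subgroupOf.mpr hkk)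

theorem Subgroup.relIndex_map_map_eq_of_inf_ker_le {G' : Type*} [Group G'] (f : G →* G')
    {H K : Subgroup G} (hHK : H ≤ K) (h : f.ker ⊓ K ≤ H) :
    (H.map f).relIndex (K.map f) = H.relIndex K := by
  rw [← Subgroup.relIndex_comap, ← Subgroup.inf_relIndex_right]
  congr 1
  refine le_antisymm ?_ (le_inf (Subgroup.le_comap_map f H) hHK)
  rintro x ⟨⟨y, hy, hyx⟩, hxK⟩
  rw [← mul_inv_cancel_left y x]
  refine H.mul_mem hy (h ⟨?_, K.mul_mem (K.inv_mem (hHK hy)) hxK⟩)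
  change f (y⁻¹ * x) = 1
  rw [map_mul, map_inv, hyx, inv_mul_cancel]

theorem displacementIndex_eq_relIndex (α : Monoid.End G) (U : Subgroup G) :
    displacementIndex α U = U.relIndex (U.map α) :=
  Subgroup.inf_relIndex_right _ _

/-- In the tower of the α^n(T), each step is the image under α^n of T ≤ α(T); `hker` says that this
image loses no index. -/
theorem Subgroup.relIndex_map_pow_eq_pow {α : Monoid.End G} {T : Subgroup G} (hT : T ≤ T.map α)
    (hker : ∀ n, ∀ x ∈ T.map α, (α ^ n) x = 1 → x ∈ T) (n : ℕ) :
    T.relIndex (T.map (α ^ n)) = T.relIndex (T.map α) ^ n := by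
  induction n with
  | zero => exact (congrArg _ (Subgroup.map_id T)).trans (Subgroup.relIndex_self T)
  | succ n ih =>
    have hmono := Subgroup.map_pow_mono α hT
    have h0 : T ≤ T.map (α ^ n) := fun x hx => hmono n.zero_le ⟨x, hx, rfl⟩
    rw [← Subgroup.relIndex_mul_relIndex T _ _ h0 (hmono n.le_succ), ih, pow_succ]
    congr 1
    refine (congrArg _ (Subgroup.map_pow_succ α T n)).trans ?_
    exact Subgroup.relIndex_map_map_eq_of_inf_ker_le (α ^ n) hT fun x hx => hker n x hx.2 hx.1

/-- Since α(Q) lies in W, α(T) represents all cosets of W in α(W), which gives equality at n = 1.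
For larger n, the inclusion of α^n(T) in α^n(W) suffices. -/
theorem displacementIndex_pow_le_of_eq_mul {α : Monoid.End G} {W T Q : Subgroup G} (hTW : T ≤ W)
    (hQW : Q ≤ W) (hQ : Q.map α ≤ Q) (hT : T ≤ T.map α)
    (hW : ∀ w ∈ W, ∃ t ∈ T, ∃ q ∈ Q, w = t * q)
    (hTn : ∀ n, T.map (α ^ n) ⊓ W ≤ T)
    (hker : ∀ n, ∀ x ∈ T.map α, (α ^ n) x = 1 → x ∈ T) (n : ℕ)
    (hfin : displacementIndex (α ^ n) W ≠ 0) :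
    displacementIndex α W ^ n ≤ displacementIndex (α ^ n) W := by
  have hinf : ∀ n, W.relIndex (T.map (α ^ n)) = T.relIndex (T.map (α ^ n)) := fun n => by
    rw [← Subgroup.inf_relIndex_right W]
    congr 1
    refine le_antisymm (inf_comm W _ ▸ hTn n) (le_inf hTW fun x hx => ?_)
    exact Subgroup.map_pow_mono α hT n.zero_le ⟨x, hx, rfl⟩
  have hone : displacementIndex α W = T.relIndex (T.map α) := by
    have h1 := hinf 1
    rw [Subgroup.map_pow_one] at h1
    rw [displacementIndex_eq_relIndex, ← h1]
    refine Subgroup.relIndex_eq_of_forall_exists_inv_mul_mem (Subgroup.map_mono hTW) ?_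
    rintro _ ⟨w, hw, rfl⟩
    obtain ⟨t, ht, q, hq, rfl⟩ := hW w hw
    refine ⟨α t, Subgroup.mem_map_of_mem α ht, ?_⟩
    change (α t)⁻¹ * α (t * q) ∈ W
    rw [map_mul, inv_mul_cancel_left]
    exact hQW (hQ (Subgroup.mem_map_of_mem α hq))
  rw [displacementIndex_eq_relIndex] at hfin
  rw [hone, displacementIndex_eq_relIndex, ← Subgroup.relIndex_map_pow_eq_pow hT hker]
  refine (hinf n).ge.trans ?_
  exact Subgroup.relIndex_le_of_le_right (Subgroup.map_mono hTW) hfin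

end Index

/-! ### Submultiplicativity and independence of the subgroup up to constants. -/

section Comparison

variable {G : Type*} [Group G]

theorem Subgroup.relIndex_map_map_dvd {G' : Type*} [Group G'] (f : G →* G') (H K : Subgroup G) :
    (H.map f).relIndex (K.map f) ∣ H.relIndex K := by
  rw [← Subgroup.relIndex_comap]
  exact Subgroup.relIndex_dvd_of_le_left K (Subgroup.le_comap_map f H)

theorem Subgroup.relIndex_le_relIndex_mul_relIndex {H K L : Subgroup G} (hKL : K ≤ L)
    (hHK : H.relIndex K ≠ 0) (hne : K.relIndex L ≠ 0) :
    H.relIndex L ≤ H.relIndex K * K.relIndex L := by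
  have h := Subgroup.relIndex_inf_mul_relIndex H K L
  rw [inf_of_le_left hKL] at h
  rw [h]
  refine Subgroup.relIndex_le_of_le_left inf_le_left ?_
  rw [← h]
  exact mul_ne_zero hHK hne

variable [TopologicalSpace G] [IsTopologicalGroup G]

theorem displacementIndex_pow_ne_zero {α : Monoid.End G} (hα : Continuous α) {W : Subgroup G}
    (hWo : IsOpen (W : Set G)) (hWc : IsCompact (W : Set G)) (n : ℕ) :
    displacementIndex (α ^ n) W ≠ 0 :=
  displacementIndex_ne_zero _ (Monoid.End.continuous_pow α hα n) W hWc hWo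

theorem displacementIndex_pow_le_pow {α : Monoid.End G} (hα : Continuous α) {W : Subgroup G}
    (hWo : IsOpen (W : Set G)) (hWc : IsCompact (W : Set G)) (n : ℕ) :
    displacementIndex (α ^ n) W ≤ displacementIndex α W ^ n := by
  induction n with
  | zero =>
    rw [displacementIndex_eq_relIndex, pow_zero]
    exact ((congrArg _ (Subgroup.map_id W)).trans (Subgroup.relIndex_self W)).le
  | succ n ih =>
    have h1 := displacementIndex_ne_zero α hα W hWc hWo
    have hn := displacementIndex_pow_ne_zero hα hWo hWc n
    rw [displacementIndex_eq_relIndex] at hn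
    have hle : (W ⊓ W.map α).map (α ^ n) ≤ W.map (α ^ n) := Subgroup.map_mono inf_le_left
    have hdvd := Subgroup.relIndex_map_map_dvd (α ^ n) (W ⊓ W.map α) (W.map α)
    rw [displacementIndex_eq_relIndex, Subgroup.map_pow_succ, pow_succ]
    -- The intermediate group α^n(W ∩ α(W)) lies in α^n(W), where induction applies, and its index
    -- in α^n(α(W)) divides the one-step index.
    refine (Subgroup.relIndex_le_relIndex_mul_relIndex (K := (W ⊓ W.map α).map (α ^ n))
      (Subgroup.map_mono inf_le_right) (fun h => hn ?_) (ne_zero_of_dvd_ne_zero h1 hdvd)).trans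
      (Nat.mul_le_mul ?_ (Nat.le_of_dvd (Nat.pos_of_ne_zero h1) hdvd))
    · exact Subgroup.relIndex_eq_zero_of_le_right hle h
    · refine (Subgroup.relIndex_le_of_le_right hle hn).trans ?_
      rwa [← displacementIndex_eq_relIndex]

theorem exists_displacementIndex_pow_le_mul {α : Monoid.End G} (hα : Continuous α)
    {V W : Subgroup G} (hVo : IsOpen (V : Set G)) (hVc : IsCompact (V : Set G))
    (hWo : IsOpen (W : Set G)) (hWc : IsCompact (W : Set G)) :
    ∃ C : ℕ, 0 < C ∧ ∀ n : ℕ, displacementIndex (α ^ n) V ≤ C * displacementIndex (α ^ n) W := by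
  have hIo : IsOpen ((V ⊓ W : Subgroup G) : Set G) := hVo.inter hWo
  have hVW := Subgroup.relIndex_ne_zero_of_isOpen_of_isCompact hVo hWc
  have hIV := Subgroup.relIndex_ne_zero_of_isOpen_of_isCompact hIo hVc
  -- Passing from V to V ∩ W costs [V : V ∩ W], and from there to W costs [W : V ∩ W]; applying α^n
  -- does not increase the first.
  refine ⟨(V ⊓ W).relIndex V * V.relIndex W, Nat.pos_of_ne_zero (mul_ne_zero hIV hVW),
    fun n => ?_⟩
  have himg : ∀ K : Subgroup G, IsCompact (K : Set G) → IsCompact (K.map (α ^ n) : Set G) :=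
    fun K hK => hK.image (Monoid.End.continuous_pow α hα n)
  have hne : ∀ K : Subgroup G, IsCompact (K : Set G) → (V ⊓ W).relIndex (K.map (α ^ n)) ≠ 0 :=
    fun K hK => Subgroup.relIndex_ne_zero_of_isOpen_of_isCompact hIo (himg K hK)
  have hdvd := Subgroup.relIndex_map_map_dvd (α ^ n) (V ⊓ W) V
  have hIW : (V ⊓ W).relIndex ((V ⊓ W).map (α ^ n)) ≤ V.relIndex W * W.relIndex (W.map (α ^ n)) := by
    refine (Subgroup.relIndex_le_of_le_right (Subgroup.map_mono inf_le_right) (hne W hWc)).trans ?_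
    rw [← Subgroup.relIndex_inf_mul_relIndex]
    exact Nat.mul_le_mul_right _ (Subgroup.relIndex_le_of_le_right inf_le_left hVW)
  rw [displacementIndex_eq_relIndex, displacementIndex_eq_relIndex]
  calc V.relIndex (V.map (α ^ n))
      ≤ (V ⊓ W).relIndex (V.map (α ^ n)) :=
        Subgroup.relIndex_le_of_le_left inf_le_left (hne V hVc)
    _ ≤ (V ⊓ W).relIndex ((V ⊓ W).map (α ^ n)) *
          ((V ⊓ W).map (α ^ n)).relIndex (V.map (α ^ n)) := by
        refine Subgroup.relIndex_le_relIndex_mul_relIndex (Subgroup.map_mono inf_le_left)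
          (fun h => ?_) (ne_zero_of_dvd_ne_zero hIV hdvd)
        exact hne V hVc (Subgroup.relIndex_eq_zero_of_le_right (Subgroup.map_mono inf_le_left) h)
    _ ≤ V.relIndex W * W.relIndex (W.map (α ^ n)) * (V ⊓ W).relIndex V :=
        Nat.mul_le_mul hIW (Nat.le_of_dvd (Nat.pos_of_ne_zero hIV) hdvd)
    _ = _ := by ring

end Comparison

/-! ### Open subgroups normalized by a compact subgroup. -/

section Normalized

variable {G : Type*} [Group G]

/-- The elements of `G` all of whose conjugates by elements of `L` lie in `U`. -/
def Subgroup.conjCore (U L : Subgroup G) : Subgroup G where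
  carrier := {x | ∀ l ∈ L, l * x * l⁻¹ ∈ U}
  one_mem' := fun l _ => by simp
  mul_mem' := fun {a b} ha hb l hl => by
    rw [show l * (a * b) * l⁻¹ = l * a * l⁻¹ * (l * b * l⁻¹) by group]
    exact U.mul_mem (ha l hl) (hb l hl)
  inv_mem' := fun {a} ha l hl => by
    rw [show l * a⁻¹ * l⁻¹ = (l * a * l⁻¹)⁻¹ by group]
    exact U.inv_mem (ha l hl)

theorem Subgroup.conjCore_le (U L : Subgroup G) : U.conjCore L ≤ U := fun x hx => by
  simpa using hx 1 L.one_mem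

theorem Subgroup.conj_mem_conjCore {U L : Subgroup G} {l x : G} (hl : l ∈ L)
    (hx : x ∈ U.conjCore L) : l * x * l⁻¹ ∈ U.conjCore L := fun k hk => by
  rw [show k * (l * x * l⁻¹) * k⁻¹ = k * l * x * (k * l)⁻¹ by group]
  exact hx _ (L.mul_mem hk hl)

/-- A tube-lemma argument: compactness of L gives one neighbourhood of 1 that works for all
conjugators. -/
theorem Subgroup.isOpen_conjCore [TopologicalSpace G] [IsTopologicalGroup G] {U L : Subgroup G}
    (hU : IsOpen (U : Set G)) (hL : IsCompact (L : Set G)) :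
    IsOpen (U.conjCore L : Set G) := by
  refine Subgroup.isOpen_of_mem_nhds _ (g := 1) ?_
  have key : ∀ᶠ x in 𝓝 (1 : G), ∀ l ∈ (L : Set G), l * x * l⁻¹ ∈ U := by
    refine hL.eventually_forall_of_forall_eventually fun l _ => ?_
    have hcont : ContinuousAt (fun p : G × G => p.2 * p.1 * p.2⁻¹) (1, l) :=
      ((continuous_snd.mul continuous_fst).mul continuous_snd.inv).continuousAt
    exact hcont.eventually (hU.mem_nhds (by simp [U.one_mem]))
  exact key

theorem Subgroup.exists_mul_eq_of_mem_sup {N L : Subgroup G}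
    (h : ∀ l ∈ L, ∀ y ∈ N, l * y * l⁻¹ ∈ N) {x : G} (hx : x ∈ N ⊔ L) :
    ∃ y ∈ N, ∃ l ∈ L, y * l = x := by
  have hLN : L ≤ Subgroup.normalizer (N : Set G) := fun l hl =>
    Subgroup.mem_normalizer_iff.mpr fun y => ⟨h l hl y, fun hy => by
      have := h l⁻¹ (inv_mem hl) _ hy
      rwa [show l⁻¹ * (l * y * l⁻¹) * l⁻¹⁻¹ = y by group] at this⟩
  have : x ∈ (N : Set G) * (L : Set G) := by
    rw [← Subgroup.coe_mul_of_right_le_normalizer_left N L hLN]; exact hx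
  obtain ⟨y, hy, l, hl, rfl⟩ := this
  exact ⟨y, hy, l, hl, rfl⟩

end Normalized

/-! ### Construction of the subgroup with geometric growth. -/

section Main

variable {G : Type*} [Group G] [TopologicalSpace G] [IsTopologicalGroup G] [T2Space G]

/-- If there is a compact open subgroup, then there is one whose displacement indices grow at least
geometrically with the ratio given by the first one. -/
theorem exists_displacementIndex_pow_le {α : Monoid.End G} (hα : Continuous α) {U : Subgroup G}
    (hUo : IsOpen (U : Set G)) (hUc : IsCompact (U : Set G)) :
    ∃ W : Subgroup G, IsOpen (W : Set G) ∧ IsCompact (W : Set G) ∧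
      ∀ n : ℕ, displacementIndex α W ^ n ≤ displacementIndex (α ^ n) W := by
  set L := (homoclinicSubgroup α U).topologicalClosure
  have hLc : IsCompact (L : Set G) := (closure_homoclinicSubgroup hα hUo hUc).1
  have hLα : L.map α = L := map_closure_homoclinicSubgroup hα hUo hUc
  have hLn : ∀ n : ℕ, ∀ l ∈ L, (α ^ n) l ∈ L := fun n l hl =>
    Subgroup.pow_mem_of_map_le α hLα.le n hl
  set U' := U.conjCore L
  have hU'o : IsOpen (U' : Set G) := Subgroup.isOpen_conjCore hUo hLc
  have hU'c : IsCompact (U' : Set G) :=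
    hUc.of_isClosed_subset (U'.isClosed_of_isOpen hU'o) (Subgroup.conjCore_le U L)
  obtain ⟨N, hN⟩ := exists_finiteForwardCore_eq_mul hα hU'o hU'c
  set Y := finiteForwardCore α U' N
  have hYU : Y ≤ U := (finiteForwardCore_le N).trans (Subgroup.conjCore_le U L)
  have hYo : IsOpen (Y : Set G) := isOpen_finiteForwardCore hα hU'o N
  have hYc : IsCompact (Y : Set G) := isCompact_finiteForwardCore hα hU'o hU'c N
  have hLY : ∀ l ∈ L, ∀ y ∈ Y, l * y * l⁻¹ ∈ Y := fun l hl y hy =>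
    conj_mem_finiteForwardCore (fun k _ hx => Subgroup.conj_mem_conjCore (hLn k l hl) hx) hy
  have hLP : ∀ l ∈ L, ∀ y ∈ backwardCore α Y, l * y * l⁻¹ ∈ backwardCore α Y := fun l hl y hy =>
    conj_mem_backwardCore hLα hLY hl hy
  have hLQ : ∀ l ∈ L, ∀ y ∈ forwardCore α Y, l * y * l⁻¹ ∈ forwardCore α Y := fun l hl y hy =>
    conj_mem_forwardCore (fun k x hx => hLY _ (hLn k l hl) x hx) hy
  set T := backwardCore α Y ⊔ L
  have hTα : T ≤ T.map α := sup_le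
    ((backwardCore_le_map hα hYo hYc).trans (Subgroup.map_mono le_sup_left))
    (hLα.ge.trans (Subgroup.map_mono le_sup_right))
  -- Such x even lie in L. The cores of Y sit inside those of U, so L, built from U, need not be
  -- rebuilt for Y.
  have key : ∀ n m : ℕ, ∀ x ∈ T.map (α ^ m), (α ^ n) x ∈ forwardCore α U → x ∈ T := by
    rintro n m _ ⟨t, ht, rfl⟩ hn
    obtain ⟨y, hy, l, hl, rfl⟩ := Subgroup.exists_mul_eq_of_mem_sup hLP ht
    change (α ^ n) ((α ^ m) (y * l)) ∈ _ at hn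
    change (α ^ m) (y * l) ∈ T
    rw [map_mul] at hn ⊢
    exact le_sup_right (a := backwardCore α Y) (mem_closure_homoclinicSubgroup hα hUo hUc
      ⟨y, backwardCore_mono hYU hy, rfl⟩ (hLn m l hl) hn)
  have hWo : IsOpen ((Y ⊔ L : Subgroup G) : Set G) := Subgroup.isOpen_mono le_sup_left hYo
  have hWc : IsCompact ((Y ⊔ L : Subgroup G) : Set G) := by
    refine (hYc.mul hLc).of_isClosed_subset ((Y ⊔ L).isClosed_of_isOpen hWo) fun x hx => ?_
    obtain ⟨y, hy, l, hl, rfl⟩ := Subgroup.exists_mul_eq_of_mem_sup hLY hx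
    exact ⟨y, hy, l, hl, rfl⟩
  have hWmul : ∀ w ∈ Y ⊔ L, ∃ t ∈ T, ∃ q ∈ forwardCore α Y, w = t * q := by
    intro w hw
    obtain ⟨y, hy, l, hl, rfl⟩ := Subgroup.exists_mul_eq_of_mem_sup hLY hw
    obtain ⟨p, hp, q, hq, rfl⟩ := hN y hy
    refine ⟨p * l, mul_mem (le_sup_left (b := L) hp) (le_sup_right (a := backwardCore α Y) hl),
      l⁻¹ * q * l⁻¹⁻¹, hLQ _ (inv_mem hl) q hq, by group⟩
  refine ⟨Y ⊔ L, hWo, hWc, fun n => ?_⟩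
  refine displacementIndex_pow_le_of_eq_mul (T := T) (Q := forwardCore α Y)
    (sup_le_sup_right backwardCore_le L) (forwardCore_le.trans le_sup_left) map_forwardCore_le hTα
    hWmul ?_ ?_ n (displacementIndex_pow_ne_zero hα hWo hWc n)
  · rintro m x ⟨hx, hxW⟩
    obtain ⟨t, ht, q, hq, rfl⟩ := hWmul x hxW
    -- Here q = t⁻¹(t q) lies in α^m(T), because T ≤ α^m(T).
    refine mul_mem ht (key 0 m q ?_ (forwardCore_mono hYU hq))
    rw [← inv_mul_cancel_left t q]
    exact mul_mem (inv_mem (Subgroup.map_pow_mono α hTα m.zero_le ⟨t, ht, rfl⟩)) hx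
  · intro m x hx hx1
    refine key m 1 x ((Subgroup.map_pow_one α T).ge hx) ?_
    rw [hx1]
    exact one_mem _

end Main

/-! ### Passage to n-th roots and conclusion. -/

theorem tendsto_rpow_one_div_of_pow_le_of_le_pow {a : ℕ → ℝ} {c C s : ℝ} (hc : 0 < c) (hC : 0 < C)
    (hs : 0 ≤ s) (hl : ∀ n, c * s ^ n ≤ a n) (hu : ∀ n, a n ≤ C * s ^ n) :
    Tendsto (fun n : ℕ => a n ^ (1 / (n : ℝ))) atTop (𝓝 s) := by
  have hlim : ∀ {b : ℝ}, 0 < b →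
      Tendsto (fun n : ℕ => (b * s ^ n) ^ (1 / (n : ℝ))) atTop (𝓝 s) := by
    intro b hb
    have h1 : Tendsto (fun n : ℕ => b ^ (1 / (n : ℝ)) * s) atTop (𝓝 (b ^ (0 : ℝ) * s)) :=
      ((Real.continuousAt_const_rpow hb.ne').tendsto.comp
        tendsto_one_div_atTop_nhds_zero_nat).mul_const s
    rw [Real.rpow_zero, one_mul] at h1
    refine h1.congr' ?_
    filter_upwards [eventually_ne_atTop 0] with n hn
    rw [Real.mul_rpow hb.le (pow_nonneg hs n), one_div, Real.pow_rpow_inv_natCast hs hn]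
  refine tendsto_of_tendsto_of_tendsto_of_le_of_le (hlim hc) (hlim hC) (fun n => ?_) fun n => ?_
  · exact Real.rpow_le_rpow (by positivity) (hl n) (by positivity)
  · exact Real.rpow_le_rpow (le_trans (by positivity) (hl n)) (hu n) (by positivity)

theorem mainTheorem4 {G : Type*} [Group G] [TopologicalSpace G] [IsTopologicalGroup G]
    [LocallyCompactSpace G] [TotallyDisconnectedSpace G]
    (α : Monoid.End G) (hα : Continuous α)
    (V : Subgroup G) (hVc : IsCompact (V : Set G)) (hVo : IsOpen (V : Set G)) :
    Tendsto (fun n : ℕ => (displacementIndex (α ^ n) V : ℝ) ^ (1 / (n : ℝ))) atTop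
      (𝓝 (scale α : ℝ)) := by
  obtain ⟨⟨U, hUc, hUo, hU⟩, hle⟩ := scale_isLeast α
  obtain ⟨W, hWo, hWc, hW⟩ := exists_displacementIndex_pow_le hα hVo hVc
  obtain ⟨C, hC, hCU⟩ := exists_displacementIndex_pow_le_mul hα hVo hVc hUo hUc
  obtain ⟨D, hD, hDW⟩ := exists_displacementIndex_pow_le_mul hα hWo hWc hVo hVc
  have hC' : (0 : ℝ) < C := by exact_mod_cast hC
  have hD' : (0 : ℝ) < D := by exact_mod_cast hD
  refine tendsto_rpow_one_div_of_pow_le_of_le_pow (inv_pos.mpr hD') hC' (Nat.cast_nonneg _)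
    (fun n => ?_) fun n => ?_
  · rw [inv_mul_le_iff₀ hD']
    have hsW : scale α ≤ displacementIndex α W := hle ⟨W, hWc, hWo, rfl⟩
    exact_mod_cast (Nat.pow_le_pow_left hsW n).trans ((hW n).trans (hDW n))
  · have h := (hCU n).trans
      (Nat.mul_le_mul_left C (displacementIndex_pow_le_pow hα hUo hUc n))
    rw [hU] at h
    exact_mod_cast h
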